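/- Let $X$ and $Y$ be real locally convex Hausdorff topological vector spaces, $M : X \to Y$ a continuous linear mapping, and let $K = \{ y \in Y \mid \langle y_j^*, y\rangle \le 0,\ j=1,\dots,q\}$ be a polyhedral convex cone, where $y_j^* \in Y^*\setminus\{0\}$ for $j=1,\dots,q$. A subset $C$ of $X$ is called a generalized polyhedral convex set if there are a closed affine subspace $L \subset X$, functionals $x_1^*,\dots,x_p^* \in X^*$ and real numbers $\alpha_1,\dots,\alpha_p$ such that $C = \{ x \in X \mid x \in L,\ \langle x_i^*, x\rangle \le \alpha_i,\ i=1,\dots,p\}$. Let $D \subset X$ be a generalized polyhedral convex set, put $\ell(K) = K \cap (-K)$, and let $E$ be the set of efficient solutions of the vector optimization problem $$\mathrm{(VLP)}\qquad {\min}_K \{ Mx \mid x \in D\},$$ that is, the set of all $u \in D$ for which there is no $x \in D$ with $Mu - Mx \in K \setminus \ell(K)$. Then $E$ is the union of finitely many generalized polyhedral convex sets. -/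

import Mathlib

open scoped Pointwise

namespace VLP

/-- Generalized polyhedral convex sets: the intersection of a closed affine subspace with
finitely many closed half-spaces given by continuous linear functionals. The empty set
qualifies in any case (use the functional `0` and the bound `-1`). -/
def IsGeneralizedPolyhedral {X : Type*} [AddCommGroup X] [Module ℝ X] [TopologicalSpace X]
    (C : Set X) : Prop :=
  ∃ (p : ℕ) (f : Fin p → StrongDual ℝ X) (α : Fin p → ℝ) (L : AffineSubspace ℝ X),
    IsClosed (L : Set X) ∧ C = {x : X | x ∈ L ∧ ∀ i, f i x ≤ α i}

/-- Polyhedral convex cones: the solution sets of finite systems of homogeneous linear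
inequalities given by nonzero continuous linear functionals (the empty system gives the
whole space). -/
def IsPolyhedralCone {Y : Type*} [AddCommGroup Y] [Module ℝ Y] [TopologicalSpace Y]
    (K : Set Y) : Prop :=
  ∃ (q : ℕ) (g : Fin q → StrongDual ℝ Y),
    (∀ j, g j ≠ 0) ∧ K = {y : Y | ∀ j, g j y ≤ 0}

/-- The lineality space `K ∩ (-K)` of a cone. -/
def lineality {Y : Type*} [AddCommGroup Y] (K : Set Y) : Set Y := K ∩ -K

/-- The set of efficient solutions of the problem of minimizing `M x` over `x ∈ D` with respect
to the cone `K`: the `u ∈ D` such that no `x ∈ D` satisfies `M u - M x ∈ K \ (K ∩ -K)`. -/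
def efficientSet {X Y : Type*} [AddCommGroup Y]
    (M : X → Y) (D : Set X) (K : Set Y) : Set X :=
  {u : X | u ∈ D ∧ ¬ ∃ x ∈ D, M u - M x ∈ K \ lineality K}

end VLP

/-!
Write `h j = g j ∘ M`, where the `g j` are the functionals defining `K`, and let
`D = {x ∈ L | ∀ i, f i x ≤ α i}`. A point `u ∈ D` fails to be efficient exactly when some direction
`v` of `L` improves it: `0 ≤ h j v` for all `j`, `0 < h j v` for some `j`, and `u + v ∈ D`. These
conditions on the `h j` are invariant under positive scaling of `v`, and a sufficiently short step
from `u` can violate only those constraints that are active at `u`. So inefficiency of `u` means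
that there is an improving direction `v` with `f i v ≤ 0` for all `i` active at `u`
(`mem_efficientSet_iff`). Thus efficiency depends only on the set of active constraints, and it
persists when that set grows. Therefore the efficient set is the union of the faces
`{x ∈ D | ∀ i ∈ I, f i x = α i}` over those index sets `I` that admit no improving direction; there
are finitely many of them, and each face is generalized polyhedral.
-/

namespace VLP

/-- The inequalities in the definition of a generalized polyhedral set may be indexed by any
finite type. -/
theorem isGeneralizedPolyhedral_of_finite {X ι : Type*} [AddCommGroup X] [Module ℝ X]
    [TopologicalSpace X] [Finite ι] (f : ι → StrongDual ℝ X) (α : ι → ℝ)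
    (L : AffineSubspace ℝ X) (hL : IsClosed (L : Set X)) :
    IsGeneralizedPolyhedral {x : X | x ∈ L ∧ ∀ i, f i x ≤ α i} := by
  obtain ⟨p, ⟨e⟩⟩ := Finite.exists_equiv_fin ι
  refine ⟨p, f ∘ e.symm, α ∘ e.symm, L, hL, ?_⟩
  ext x
  simp [e.symm.forall_congr_left]

/-- The face of a generalized polyhedral set on which the constraints in `I` are active. -/
theorem isGeneralizedPolyhedral_face {X ι : Type*} [AddCommGroup X] [Module ℝ X]
    [TopologicalSpace X] [IsTopologicalAddGroup X] [Finite ι]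
    (f : ι → StrongDual ℝ X) (α : ι → ℝ)
    (L : AffineSubspace ℝ X) (hL : IsClosed (L : Set X)) (I : Set ι) :
    IsGeneralizedPolyhedral {x : X | x ∈ L ∧ (∀ i, f i x ≤ α i) ∧ ∀ i ∈ I, f i x = α i} := by
  convert isGeneralizedPolyhedral_of_finite (ι := ι ⊕ I)
    (Sum.elim f fun i => -f i) (Sum.elim α fun i => -α i) L hL using 1
  ext x
  simp only [Set.mem_ofPred_eq, Sum.forall, Sum.elim_inl, Sum.elim_inr, Subtype.forall,
    neg_apply, neg_le_neg_iff]
  exact and_congr_right fun _ => and_congr_right fun hx =>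
    forall₂_congr fun i _ => ⟨fun h => h.ge, fun h => le_antisymm (hx i) h⟩

theorem mem_diff_lineality_iff {Y ι : Type*} [AddCommGroup Y] [Module ℝ Y] [TopologicalSpace Y]
    (g : ι → StrongDual ℝ Y) (y : Y) :
    y ∈ {y : Y | ∀ j, g j y ≤ 0} \ lineality {y : Y | ∀ j, g j y ≤ 0} ↔
      (∀ j, g j y ≤ 0) ∧ ∃ j, g j y < 0 := by
  simp only [lineality, Set.mem_sdiff, Set.mem_inter_iff, Set.mem_neg, Set.mem_ofPred_eq, map_neg,
    neg_nonpos, not_and, not_forall, not_le]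
  exact and_congr_right fun h => ⟨fun h' => h' h, fun h' _ => h'⟩

/-- There is a direction `v` in `V` such that a step along `v` improves the objective `M`, in the
sense of minimization with respect to the cone `{y | ∀ j, g j y ≤ 0}`, and increases none of the
functionals `f i`, `i ∈ I`. -/
def HasImprovingDirection {X Y ι κ : Type*} [AddCommGroup X] [Module ℝ X] [TopologicalSpace X]
    [AddCommGroup Y] [Module ℝ Y] [TopologicalSpace Y]
    (M : X →L[ℝ] Y) (g : κ → StrongDual ℝ Y) (f : ι → StrongDual ℝ X) (V : Submodule ℝ X)
    (I : Set ι) : Prop :=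
  ∃ v ∈ V, (∀ j, 0 ≤ g j (M v)) ∧ (∃ j, 0 < g j (M v)) ∧ ∀ i ∈ I, f i v ≤ 0

theorem HasImprovingDirection.mono {X Y ι κ : Type*} [AddCommGroup X] [Module ℝ X]
    [TopologicalSpace X] [AddCommGroup Y] [Module ℝ Y] [TopologicalSpace Y]
    {M : X →L[ℝ] Y} {g : κ → StrongDual ℝ Y} {f : ι → StrongDual ℝ X} {V : Submodule ℝ X}
    {I J : Set ι} (hIJ : I ⊆ J) (h : HasImprovingDirection M g f V J) :
    HasImprovingDirection M g f V I := by
  obtain ⟨v, hv, hge, hgt, hf⟩ := h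
  exact ⟨v, hv, hge, hgt, fun i hi => hf i (hIJ hi)⟩

/-- If a direction is feasible for the constraints that are active at `u`, then a short step along
it is feasible for all constraints. -/
theorem exists_pos_step {X ι : Type*} [AddCommGroup X] [Module ℝ X] [TopologicalSpace X]
    [Finite ι] (f : ι → StrongDual ℝ X) (α : ι → ℝ) {u v : X} (hu : ∀ i, f i u ≤ α i)
    (hv : ∀ i, f i u = α i → f i v ≤ 0) :
    ∃ t : ℝ, 0 < t ∧ ∀ i, f i (u + t • v) ≤ α i := by
  have key : ∀ᶠ t : ℝ in nhdsWithin 0 (Set.Ioi 0), ∀ i, f i (u + t • v) ≤ α i := by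
    refine Filter.eventually_all.2 fun i => ?_
    simp only [map_add, map_smul, smul_eq_mul]
    rcases (hu i).eq_or_lt with h | h
    · filter_upwards [self_mem_nhdsWithin] with t ht
      have : t * f i v ≤ 0 := mul_nonpos_of_nonneg_of_nonpos (le_of_lt ht) (hv i h)
      linarith
    · have hc : Continuous fun t : ℝ => f i u + t * f i v := by fun_prop
      have h0 : f i u + 0 * f i v < α i := by simpa using h
      exact nhdsWithin_le_nhds ((hc.continuousAt.eventually_lt_const h0).mono fun t ht => ht.le)
  obtain ⟨t, ht, hpos⟩ := (key.and self_mem_nhdsWithin).exists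
  exact ⟨t, hpos, ht⟩

/-- Efficiency of a feasible point depends only on the set of constraints active at it. -/
theorem mem_efficientSet_iff {X Y ι κ : Type*} [AddCommGroup X] [Module ℝ X] [TopologicalSpace X]
    [AddCommGroup Y] [Module ℝ Y] [TopologicalSpace Y] [Finite ι]
    (M : X →L[ℝ] Y) (g : κ → StrongDual ℝ Y) (f : ι → StrongDual ℝ X) (α : ι → ℝ)
    (L : AffineSubspace ℝ X) (u : X) :
    u ∈ efficientSet M {x : X | x ∈ L ∧ ∀ i, f i x ≤ α i} {y : Y | ∀ j, g j y ≤ 0} ↔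
      (u ∈ L ∧ ∀ i, f i u ≤ α i) ∧
        ¬ HasImprovingDirection M g f L.direction {i | f i u = α i} := by
  refine and_congr_right fun ⟨huL, hu⟩ => not_congr ⟨?_, ?_⟩
  · rintro ⟨x, ⟨hxL, hx⟩, hK⟩
    obtain ⟨hle, j, hj⟩ := (mem_diff_lineality_iff g _).1 hK
    simp only [map_sub, sub_nonpos, sub_neg] at hle hj
    refine ⟨x - u, L.vsub_mem_direction hxL huL, ?_, ⟨j, ?_⟩, fun i hi => ?_⟩
    · simpa using hle
    · simpa using hj
    · have hi : f i u = α i := hi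
      simpa [hi] using hx i
  · rintro ⟨v, hv, hge, ⟨j, hj⟩, hf⟩
    obtain ⟨t, ht, hstep⟩ := exists_pos_step f α hu hf
    refine ⟨u + t • v, ⟨?_, hstep⟩, (mem_diff_lineality_iff g _).2 ⟨fun k => ?_, j, ?_⟩⟩
    · rw [add_comm]
      exact AffineSubspace.vadd_mem_of_mem_direction (L.direction.smul_mem t hv) huL
    · simpa using mul_nonneg ht.le (hge k)
    · simpa using mul_pos ht hj

end VLP

theorem theorem3p2
    {X : Type*} [AddCommGroup X] [Module ℝ X] [TopologicalSpace X] [IsTopologicalAddGroup X]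
    [ContinuousSMul ℝ X] [LocallyConvexSpace ℝ X] [T2Space X]
    {Y : Type*} [AddCommGroup Y] [Module ℝ Y] [TopologicalSpace Y] [IsTopologicalAddGroup Y]
    [ContinuousSMul ℝ Y] [LocallyConvexSpace ℝ Y] [T2Space Y]
    (M : X →L[ℝ] Y) (D : Set X) (hD : VLP.IsGeneralizedPolyhedral D)
    (K : Set Y) (hK : VLP.IsPolyhedralCone K) :
    ∃ (n : ℕ) (F : Fin n → Set X),
      (∀ i, VLP.IsGeneralizedPolyhedral (F i)) ∧ VLP.efficientSet M D K = ⋃ i, F i := by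
  obtain ⟨p, f, α, L, hL, rfl⟩ := hD
  obtain ⟨q, g, -, rfl⟩ := hK
  obtain ⟨n, ⟨e⟩⟩ := Finite.exists_equiv_fin
    {I : Set (Fin p) // ¬ VLP.HasImprovingDirection M g f L.direction I}
  refine ⟨n, fun k => {x : X | x ∈ L ∧ (∀ i, f i x ≤ α i) ∧ ∀ i ∈ (e.symm k).1, f i x = α i},
    fun k => VLP.isGeneralizedPolyhedral_face f α L hL _, ?_⟩
  ext u
  rw [VLP.mem_efficientSet_iff, Set.mem_iUnion]
  constructor
  · rintro ⟨⟨huL, hu⟩, hI⟩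
    refine ⟨e ⟨_, hI⟩, huL, hu, ?_⟩
    simp
  · rintro ⟨k, huL, hu, hk⟩
    exact ⟨⟨huL, hu⟩, fun h => (e.symm k).2 (h.mono hk)⟩
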